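/- Let $\mathcal M\subset\mathbb R^{\mathsf N}$ be a nonempty compact smooth embedded $d$-dimensional submanifold with Riemannian volume measure $\mu$ and Laplace–Beltrami operator $\mathcal L=-\mathrm{div}\circ\nabla$ on $L^2(\mathcal M)=L^2(\mathcal M,\mu)$. Let $x_1,\dots,x_n$ ($n\ge1$) be i.i.d. points, uniformly distributed on $\mathcal M$ (with law $\mu/\mu(\mathcal M)$), and let $\epsilon>0$. The geometric graph $\mathbf G_n$ on these points has edge weights $w_{ij}=K_\epsilon(\|x_i-x_j\|^2/\epsilon)$, where $K_\epsilon$ is either of the kernels $$K_\epsilon(s)=\frac1n\,\frac{1}{\epsilon^{d/2+1}(4\pi)^{d/2}}\,e^{-s/4}\ \text{ (dense graph)},\qquad K_\epsilon(s)=\frac1n\,\frac{d+2}{\epsilon^{d/2+1}\alpha_d}\,\mathbf 1_{[0,1]}(s)\ \text{ (relatively sparse graph)},$$ with $\alpha_d$ the volume of the unit ball of $\mathbb R^d$; its Laplacian is $\mathbf L_n^\epsilon=\mathrm{diag}(\mathbf A\mathbf 1)-\mathbf A$ with $\mathbf A=(w_{ij})$. Put $\|\mathbf u\|_{L^2(\mathbf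 G_n)}^2=\frac1n\sum_{i}\mathbf u_i^2$ and $(\mathbf P_nf)_i=f(x_i)$. For an impulse response $\tilde h$ integrable on $(0,\infty)$ put $\mathbf h(\mathcal L)f=\int_0^\infty\tilde h(t)e^{-t\mathcal L}f\,dt$ and $\mathbf h(\mathbf L_n^\epsilon)\mathbf u=\int_0^\infty\tilde h(t)e^{-t\mathbf L_n^\epsilon}\mathbf u\,dt$. Let $L\ge1$ and let $\mathbf H=(\tilde h_l^{pq})$, $1\le l\le L$, $1\le p\le F_l$, $1\le q\le F_{l-1}$, be such impulse responses, with $F_0=F_L=1$ and $F_l=F$ for $1\le l\le L-1$, all non-amplifying: $\left|\int_0^\infty\tilde h_l^{pq}(t)e^{-t\lambda}\,dt\right|\le1$ for all $\lambda\ge0$. Let $\sigma:\mathbb R\to\mathbb R$ satisfy $|\sigma(a)-\sigma(b)|\le|a-b|$ and $\sigma(0)=0$. For $f\in L^2(\mathcal M)$ let $f_0^1=f$, $f_l^p=\sigma\big(\sum_{q=1}^{F_{l-1}}\mathbf h_l^{pq}(\mathcal L)f_{l-1}^q\big)$, and $\boldsymbol\Phi(\mathbf H,\mathcal L,f)=f_L^1$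 (the MNN); the GNN $\boldsymbol\Phi(\mathbf H,\mathbf L_n^\epsilon,\mathbf x)$ is defined in the same way, with $\mathbf L_n^\epsilon$ in place of $\mathcal L$ and $\mathbf x_0^1=\mathbf x\in\mathbb R^n$ in place of $f$. Let $\Delta_{fil,n}\in\mathbb R$. Consider the filter bounds $$\big\|\mathbf h_l^{pq}(\mathbf L_n^\epsilon)\mathbf P_nf_{l-1}^q-\mathbf P_n\mathbf h_l^{pq}(\mathcal L)f_{l-1}^q\big\|_{L^2(\mathbf G_n)}\le\Delta_{fil,n}\qquad(1\le l\le L,\ 1\le p\le F_l,\ 1\le q\le F_{l-1})\qquad(1)$$ and the network bound $$\big\|\boldsymbol\Phi(\mathbf H,\mathbf L_n^\epsilon,\mathbf P_nf)-\mathbf P_n\boldsymbol\Phi(\mathbf H,\mathcal L,f)\big\|_{L^2(\mathbf G_n)}\le L\,F^{L-1}\,\Delta_{fil,n}.\qquad(2)$$ Theorem. For the dense and for the relatively sparse graphs: (i) almost surely, if all the bounds (1) hold, then (2) holds. (ii) If the bounds (1) hold jointly with probability at least $1-\delta$, then (2) holds with probability at least $1-\delta$. (iii) If each single bound in (1) holds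 with probability at least $1-\delta$, then (2) holds with probability at least $1-\delta\sum_{l=1}^{L}F_lF_{l-1}$. -/

import Mathlib

open MeasureTheory ProbabilityTheory
open scoped ContDiff ENNReal NNReal Matrix InnerProductSpace

noncomputable section

namespace MNN

/-! ### Embedded manifolds, volume and the Laplace–Beltrami operator -/

/-- `M` is a smooth `d`-dimensional embedded submanifold (without boundary) of `ℝ^N`: around every
point of `M` there is a smooth diffeomorphism between open subsets of `ℝ^N` that flattens `M` to a
`d`-dimensional linear subspace. -/
def IsSmoothSubmanifold {N : ℕ} (d : ℕ) (M : Set (EuclideanSpace ℝ (Fin N))) : Prop :=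
  ∀ x ∈ M, ∃ (V : Submodule ℝ (EuclideanSpace ℝ (Fin N)))
    (Φ : OpenPartialHomeomorph (EuclideanSpace ℝ (Fin N)) (EuclideanSpace ℝ (Fin N))),
    Module.finrank ℝ V = d ∧ x ∈ Φ.source ∧
    ContDiffOn ℝ ∞ Φ Φ.source ∧ ContDiffOn ℝ ∞ Φ.symm Φ.target ∧
    ∀ y ∈ Φ.source, (y ∈ M ↔ Φ y ∈ V)

/-- The Riemannian volume measure of a `d`-dimensional submanifold `M ⊆ ℝ^N`, as a measure on the
ambient space: the `d`-dimensional Hausdorff measure, normalised to agree with Lebesgue measure on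
`d`-dimensional Euclidean space, restricted to `M`. -/
def vol {N : ℕ} (d : ℕ) (M : Set (EuclideanSpace ℝ (Fin N))) :
    Measure (EuclideanSpace ℝ (Fin N)) :=
  (Measure.euclideanHausdorffMeasure d).restrict M

/-- The uniform probability distribution on `M`: the normalised volume measure. -/
def uniform {N : ℕ} (d : ℕ) (M : Set (EuclideanSpace ℝ (Fin N))) :
    Measure (EuclideanSpace ℝ (Fin N)) :=
  (vol d M Set.univ)⁻¹ • vol d M

/-- Manifold signals: the real Hilbert space `L²(M)`. -/
abbrev Signal {N : ℕ} (d : ℕ) (M : Set (EuclideanSpace ℝ (Fin N))) : Type :=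
  Lp ℝ 2 (vol d M)

/-- Square integrable fields of vectors of `ℝ^N` along `M`. -/
abbrev VectorField {N : ℕ} (d : ℕ) (M : Set (EuclideanSpace ℝ (Fin N))) : Type :=
  Lp (EuclideanSpace ℝ (Fin N)) 2 (vol d M)

/-- The tangent space of `M` at `x`: the velocities at `x` of smooth curves in `M`
(for a submanifold these already form a linear subspace). -/
def tangentSpace {N : ℕ} (M : Set (EuclideanSpace ℝ (Fin N))) (x : EuclideanSpace ℝ (Fin N)) :
    Submodule ℝ (EuclideanSpace ℝ (Fin N)) :=
  Submodule.span ℝ {v | ∃ γ : ℝ → EuclideanSpace ℝ (Fin N),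
    ContDiff ℝ ∞ γ ∧ γ 0 = x ∧ (∀ᶠ t in nhds 0, γ t ∈ M) ∧ deriv γ 0 = v}

/-- The intrinsic gradient at `x` of the restriction to `M` of a smooth function `F` on `ℝ^N`:
the tangential part of the ambient gradient. -/
def tangentialGradient {N : ℕ} (M : Set (EuclideanSpace ℝ (Fin N)))
    (F : EuclideanSpace ℝ (Fin N) → ℝ) (x : EuclideanSpace ℝ (Fin N)) :
    EuclideanSpace ℝ (Fin N) :=
  (tangentSpace M x).starProjection (gradient F x)

/-- The graph of the intrinsic gradient `∇ : L²(M) → L²(TM)`: the `L²`-closure of its graph on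
smooth functions. On a compact `M` the smooth functions are exactly the restrictions of smooth
functions on the ambient space, and the domain of the closure is the Sobolev space `H¹(M)`. -/
def gradientGraph {N : ℕ} (d : ℕ) (M : Set (EuclideanSpace ℝ (Fin N))) :
    Submodule ℝ (Signal d M × VectorField d M) :=
  (Submodule.span ℝ {p : Signal d M × VectorField d M |
    ∃ F : EuclideanSpace ℝ (Fin N) → ℝ, ContDiff ℝ ∞ F ∧
      p.1 =ᵐ[vol d M] F ∧ p.2 =ᵐ[vol d M] tangentialGradient M F}).topologicalClosure

/-- The graph of the Laplace–Beltrami operator `ℒ = -div ∘ ∇`, where `-div` is the adjoint of `∇`: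
`ℒ u = g` means that `u` has a gradient `w` in `L²` with `⟪w, ∇ v⟫ = ⟪g, v⟫` for all `v` in the
domain of `∇`. -/
def laplaceBeltrami {N : ℕ} (d : ℕ) (M : Set (EuclideanSpace ℝ (Fin N))) :
    Submodule ℝ (Signal d M × Signal d M) where
  carrier := {p | ∃ w : VectorField d M, (p.1, w) ∈ gradientGraph d M ∧
    ∀ r ∈ gradientGraph d M, ⟪w, r.2⟫_ℝ = ⟪p.2, r.1⟫_ℝ}
  add_mem' := by
    rintro a b ⟨w, hw, hw'⟩ ⟨z, hz, hz'⟩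
    refine ⟨w + z, Submodule.add_mem _ hw hz, fun r hr => ?_⟩
    rw [inner_add_left, hw' r hr, hz' r hr, Prod.snd_add, inner_add_left]
  zero_mem' := ⟨0, Submodule.zero_mem _, fun r _ => by simp⟩
  smul_mem' := by
    rintro c a ⟨w, hw, hw'⟩
    refine ⟨c • w, Submodule.smul_mem _ c hw, fun r hr => ?_⟩
    rw [real_inner_smul_left, hw' r hr, Prod.smul_snd, real_inner_smul_left]

/-- The eigenspace `{u | ℒ u = lam u}` of the Laplace–Beltrami operator
(it is already closed; the closure is taken to have the orthogonal projection at hand). -/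
def eigenspace {N : ℕ} (d : ℕ) (M : Set (EuclideanSpace ℝ (Fin N))) (lam : ℝ) :
    Submodule ℝ (Signal d M) :=
  ((laplaceBeltrami d M).comap
    (LinearMap.prod LinearMap.id (lam • LinearMap.id))).topologicalClosure

instance {N : ℕ} (d : ℕ) (M : Set (EuclideanSpace ℝ (Fin N))) (lam : ℝ) :
    (eigenspace d M lam).HasOrthogonalProjection := by
  have : CompleteSpace (eigenspace d M lam) := Submodule.topologicalClosure.completeSpace _
  infer_instance

/-- The manifold shift (heat semigroup) `e^{-tℒ}`, through the discrete spectrum of `ℒ`: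
the sum over all eigenvalues `lam` of `e^{-t lam}` times the orthogonal projection onto the
eigenspace. -/
def heat {N : ℕ} (d : ℕ) (M : Set (EuclideanSpace ℝ (Fin N))) (t : ℝ) (f : Signal d M) :
    Signal d M :=
  ∑' lam : ℝ, Real.exp (-(t * lam)) • (eigenspace d M lam).starProjection f

/-- The manifold filter with impulse response `h`: `h(ℒ) f = ∫₀^∞ h(t) e^{-tℒ} f dt`. -/
def manifoldFilter {N : ℕ} (d : ℕ) (M : Set (EuclideanSpace ℝ (Fin N))) (h : ℝ → ℝ)
    (f : Signal d M) : Signal d M :=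
  ∫ t in Set.Ioi (0 : ℝ), h t • heat d M t f

/-- The frequency response `∫₀^∞ h(t) e^{-t lam} dt` of the impulse response `h`. -/
def frequencyResponse (h : ℝ → ℝ) (lam : ℝ) : ℝ :=
  ∫ t in Set.Ioi (0 : ℝ), h t * Real.exp (-(t * lam))

/-- A filter is non-amplifying if its frequency response is bounded by one. -/
def NonAmplifying (h : ℝ → ℝ) : Prop :=
  ∀ lam : ℝ, 0 ≤ lam → |frequencyResponse h lam| ≤ 1

/-! ### Geometric graphs -/

/-- The two kinds of geometric graph: dense (Gaussian kernel), relatively sparse (compactly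
supported kernel). -/
inductive GraphKind
  | dense
  | sparse

/-- The weight function `K_ε(s)`, to be evaluated at `s = ‖x - y‖² / ε`, for `n` sample points on a
`d`-dimensional manifold. -/
def kernel (κ : GraphKind) (d n : ℕ) (ε : ℝ) (s : ℝ) : ℝ :=
  match κ with
  | .dense =>
      1 / (n : ℝ) * (1 / (ε ^ ((d : ℝ) / 2 + 1) * (4 * Real.pi) ^ ((d : ℝ) / 2))) *
        Real.exp (-s / 4)
  | .sparse =>
      1 / (n : ℝ) * (((d : ℝ) + 2) / (ε ^ ((d : ℝ) / 2 + 1) *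
        volume.real (Metric.ball (0 : EuclideanSpace ℝ (Fin d)) 1))) *
        Set.indicator (Set.Icc (0 : ℝ) 1) (fun _ => (1 : ℝ)) s

/-- The weighted adjacency matrix of the geometric graph on the points `x 0, …, x (n - 1)`. -/
def adjacency {N : ℕ} (κ : GraphKind) (d : ℕ) (ε : ℝ) {n : ℕ}
    (x : Fin n → EuclideanSpace ℝ (Fin N)) : Matrix (Fin n) (Fin n) ℝ :=
  Matrix.of fun i j => kernel κ d n ε (‖x i - x j‖ ^ 2 / ε)

/-- The graph Laplacian `diag(A 1) - A` of the geometric graph. -/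
def graphLaplacian {N : ℕ} (κ : GraphKind) (d : ℕ) (ε : ℝ) {n : ℕ}
    (x : Fin n → EuclideanSpace ℝ (Fin N)) : Matrix (Fin n) (Fin n) ℝ :=
  Matrix.diagonal (adjacency κ d ε x *ᵥ fun _ => 1) - adjacency κ d ε x

/-- The graph filter with impulse response `h` on a graph with Laplacian `S`:
`h(S) u = ∫₀^∞ h(t) e^{-tS} u dt`. -/
def graphFilter {n : ℕ} (h : ℝ → ℝ) (S : Matrix (Fin n) (Fin n) ℝ) (u : Fin n → ℝ) : Fin n → ℝ :=
  ∫ t in Set.Ioi (0 : ℝ), h t • (NormedSpace.exp (-t • S) *ᵥ u)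

/-- The norm of `L²(G_n)`: `‖u‖² = (1/n) ∑ᵢ uᵢ²`. -/
def graphNorm {n : ℕ} (u : Fin n → ℝ) : ℝ :=
  Real.sqrt (1 / (n : ℝ) * ∑ i, u i ^ 2)

/-- The sampling operator `P_n`: evaluation at the points `x 0, …, x (n - 1)`. An element of `L²(M)`
is a class of functions up to null sets; at independent uniformly distributed points the result
almost surely does not depend on the representative. -/
def sample {N : ℕ} {d : ℕ} {M : Set (EuclideanSpace ℝ (Fin N))} {n : ℕ}
    (x : Fin n → EuclideanSpace ℝ (Fin N)) (f : Signal d M) : Fin n → ℝ :=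
  fun i => f (x i)

/-! ### Neural networks -/

/-- A normalized Lipschitz nonlinearity. -/
structure NormalizedLipschitz (σ : ℝ → ℝ) : Prop where
  abs_sub_le : ∀ a b : ℝ, |σ a - σ b| ≤ |a - b|
  map_zero : σ 0 = 0

theorem NormalizedLipschitz.lipschitzWith {σ : ℝ → ℝ} (hσ : NormalizedLipschitz σ) :
    LipschitzWith 1 σ :=
  LipschitzWith.of_dist_le_mul fun a b => by
    simpa [Real.dist_eq] using hσ.abs_sub_le a b

/-- The number of features after layer `l` in a network with `L` layers: one input and one output
feature, `F` features in the hidden layers. -/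
def width (L F l : ℕ) : ℕ := if l = 0 ∨ l = L then 1 else F

theorem width_zero (L F : ℕ) : width L F 0 = 1 := by simp [width]

theorem width_last (L F : ℕ) : width L F L = 1 := by simp [width]

/-- An architecture: `H l p q` is the impulse response of the filter from the `q`-th feature after
`l` layers to the `p`-th feature after `l + 1` layers (only `l < L` matters). -/
abbrev Architecture (L F : ℕ) : Type :=
  (l : ℕ) → Fin (width L F (l + 1)) → Fin (width L F l) → ℝ → ℝ

/-- The features after `l` layers of the manifold neural network with input `f`:
`f_{l+1}^p = σ (∑_q h_{l+1}^{pq}(ℒ) f_l^q)`. -/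
def mnnFeature {N : ℕ} {d : ℕ} {M : Set (EuclideanSpace ℝ (Fin N))} {L F : ℕ}
    {σ : ℝ → ℝ} (hσ : NormalizedLipschitz σ) (H : Architecture L F) (f : Signal d M) :
    (l : ℕ) → Fin (width L F l) → Signal d M
  | 0 => fun _ => f
  | l + 1 => fun p => hσ.lipschitzWith.compLp hσ.map_zero
      (∑ q, manifoldFilter d M (H l p q) (mnnFeature hσ H f l q))

/-- The features after `l` layers of the graph neural network with the same architecture, on a
graph with Laplacian `S` and input `u`: `x_{l+1}^p = σ (∑_q h_{l+1}^{pq}(S) x_l^q)`. -/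
def gnnFeature {L F n : ℕ} (σ : ℝ → ℝ) (H : Architecture L F) (S : Matrix (Fin n) (Fin n) ℝ)
    (u : Fin n → ℝ) : (l : ℕ) → Fin (width L F l) → Fin n → ℝ
  | 0 => fun _ => u
  | l + 1 => fun p i => σ ((∑ q, graphFilter (H l p q) S (gnnFeature σ H S u l q)) i)

/-- The output of the manifold neural network. -/
def mnn {N : ℕ} {d : ℕ} {M : Set (EuclideanSpace ℝ (Fin N))} {L F : ℕ}
    {σ : ℝ → ℝ} (hσ : NormalizedLipschitz σ) (H : Architecture L F) (f : Signal d M) :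
    Signal d M :=
  mnnFeature hσ H f L ⟨0, by rw [width_last]; exact Nat.one_pos⟩

/-- The output of the graph neural network. -/
def gnn {L F n : ℕ} (σ : ℝ → ℝ) (H : Architecture L F) (S : Matrix (Fin n) (Fin n) ℝ)
    (u : Fin n → ℝ) : Fin n → ℝ :=
  gnnFeature σ H S u L ⟨0, by rw [width_last]; exact Nat.one_pos⟩

/-- The discrepancy `‖h(L_n) P_n g - P_n h(ℒ) g‖` in `L²(G_n)` between the graph filter and the
manifold filter with impulse response `h`, for the input signal `g` and the sample points `x`. -/
def filterError {N : ℕ} {d : ℕ} {M : Set (EuclideanSpace ℝ (Fin N))} {n : ℕ}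
    (κ : GraphKind) (ε : ℝ) (x : Fin n → EuclideanSpace ℝ (Fin N)) (h : ℝ → ℝ)
    (g : Signal d M) : ℝ :=
  graphNorm (graphFilter h (graphLaplacian κ d ε x) (sample x g) -
    sample x (manifoldFilter d M h g))

/-- The discrepancy `‖Φ(H, L_n, P_n f) - P_n Φ(H, ℒ, f)‖` in `L²(G_n)` between the graph and the
manifold neural network, for the input signal `f` and the sample points `x`. -/
def networkError {N : ℕ} {d : ℕ} {M : Set (EuclideanSpace ℝ (Fin N))} {L F n : ℕ}
    {σ : ℝ → ℝ} (hσ : NormalizedLipschitz σ) (H : Architecture L F)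
    (κ : GraphKind) (ε : ℝ) (x : Fin n → EuclideanSpace ℝ (Fin N)) (f : Signal d M) : ℝ :=
  graphNorm (gnn σ H (graphLaplacian κ d ε x) (sample x f) - sample x (mnn hσ H f))

/-- Every filter of the architecture satisfies the discrepancy bound `Δ` on the feature of the
manifold neural network that it acts on. -/
def FiltersClose {N : ℕ} {d : ℕ} {M : Set (EuclideanSpace ℝ (Fin N))} {L F n : ℕ}
    {σ : ℝ → ℝ} (hσ : NormalizedLipschitz σ) (H : Architecture L F)
    (κ : GraphKind) (ε : ℝ) (x : Fin n → EuclideanSpace ℝ (Fin N)) (f : Signal d M)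
    (Δ : ℝ) : Prop :=
  ∀ l < L, ∀ p q, filterError κ ε x (H l p q) (mnnFeature hσ H f l q) ≤ Δ

end MNN

end

/-!
The network bound is deterministic once two facts are available.

*Graph side.* The graph Laplacian is symmetric and positive semidefinite, because the weights are
symmetric and nonnegative. Diagonalising it in an orthonormal basis turns a graph filter into
multiplication by its frequency response at the eigenvalues (`graphFilter_eq_conj`); the
eigenvalues are nonnegative, so a non-amplifying filter is linear and non-expansive for the norm of
`L²(G_n)` (`graphNorm_graphFilter_sub_le`).

*Manifold side.* The law of each sample point is absolutely continuous with respect to the volume,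
so almost surely every almost-everywhere identity between finitely many `L²` classes holds at all
sample points. Hence almost surely sampling commutes with the sums and the nonlinearity in each of
the finitely many features of the manifold network (`ae_sample_mnnFeature_succ`).

On the almost sure event, if `e l` bounds the error of the features after `l` layers, the triangle
inequality and the `1`-Lipschitz nonlinearity give `e (l + 1) ≤ width l * (e l + Δ)` with `e 0 = 0`,
and so `e l ≤ l * F ^ (l - 1) * Δ` (`graphNorm_feature_sub_le`). The two probability bounds follow
by monotonicity of `P` up to null sets and by the union bound.
-/

namespace MNN

/-! ### The norm of `L²(G_n)` -/

theorem graphNorm_eq_norm {n : ℕ} (u : Fin n → ℝ) :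
    graphNorm u = √(1 / (n : ℝ)) * ‖WithLp.toLp 2 u‖ := by
  rw [graphNorm, Real.sqrt_mul (by positivity), EuclideanSpace.norm_eq]
  simp

theorem graphNorm_eq_dotProduct {n : ℕ} (u : Fin n → ℝ) :
    graphNorm u = √(1 / (n : ℝ) * (u ⬝ᵥ u)) := by
  simp [graphNorm, dotProduct, sq]

theorem graphNorm_zero {n : ℕ} : graphNorm (0 : Fin n → ℝ) = 0 := by
  simp [graphNorm]

theorem graphNorm_nonneg {n : ℕ} (u : Fin n → ℝ) : 0 ≤ graphNorm u :=
  Real.sqrt_nonneg _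

theorem graphNorm_add_le {n : ℕ} (u v : Fin n → ℝ) :
    graphNorm (u + v) ≤ graphNorm u + graphNorm v := by
  simp only [graphNorm_eq_norm, ← mul_add, WithLp.toLp_add]
  gcongr
  exact norm_add_le _ _

theorem graphNorm_sum_le {n : ℕ} {ι : Type*} (s : Finset ι) (u : ι → Fin n → ℝ) :
    graphNorm (∑ i ∈ s, u i) ≤ ∑ i ∈ s, graphNorm (u i) :=
  Finset.le_sum_of_subadditive _ graphNorm_zero.le graphNorm_add_le s u

theorem graphNorm_mono {n : ℕ} {u v : Fin n → ℝ} (h : ∀ i, |u i| ≤ |v i|) :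
    graphNorm u ≤ graphNorm v := by
  refine Real.sqrt_le_sqrt (mul_le_mul_of_nonneg_left ?_ (by positivity))
  exact Finset.sum_le_sum fun i _ => sq_le_sq.2 (h i)

/-! ### Positivity of the graph Laplacian -/

theorem kernel_nonneg (κ : GraphKind) (d n : ℕ) {ε : ℝ} (hε : 0 < ε) (s : ℝ) :
    0 ≤ kernel κ d n ε s := by
  cases κ with
  | dense => simp only [kernel]; positivity
  | sparse =>
    simp only [kernel]
    exact mul_nonneg (by positivity) (Set.indicator_nonneg (fun _ _ => zero_le_one) s)

/-- The Laplacian of a weighted graph with symmetric nonnegative weights is positive semidefinite: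
its quadratic form is `u ↦ ½ ∑ᵢⱼ Aᵢⱼ (uᵢ - uⱼ)²`. -/
theorem posSemidef_diagonal_sub {ι : Type*} [Fintype ι] [DecidableEq ι] {A : Matrix ι ι ℝ}
    (hA : A.IsSymm) (hA0 : ∀ i j, 0 ≤ A i j) :
    (Matrix.diagonal (A *ᵥ fun _ => 1) - A).PosSemidef := by
  refine .of_dotProduct_mulVec_nonneg ?_ fun u => ?_
  · rw [Matrix.IsHermitian, Matrix.conjTranspose_eq_transpose_of_trivial, Matrix.transpose_sub,
      Matrix.diagonal_transpose, hA.eq]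
  · have key : star u ⬝ᵥ ((Matrix.diagonal (A *ᵥ fun _ => 1) - A) *ᵥ u)
        = ∑ i, ∑ j, A i j * (u i * u i - u i * u j) := by
      rw [star_trivial, Matrix.sub_mulVec]
      refine Finset.sum_congr rfl fun i _ => ?_
      rw [Pi.sub_apply, Matrix.mulVec_diagonal]
      simp only [Matrix.mulVec, dotProduct, mul_one]
      rw [Finset.sum_mul, ← Finset.sum_sub_distrib, Finset.mul_sum]
      exact Finset.sum_congr rfl fun j _ => by ring
    have swap : ∑ i, ∑ j, A i j * (u i * u i - u i * u j)
        = ∑ i, ∑ j, A i j * (u j * u j - u i * u j) := by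
      rw [Finset.sum_comm]
      refine Finset.sum_congr rfl fun i _ => Finset.sum_congr rfl fun j _ => ?_
      rw [hA.apply i j]
      ring
    have sq_form : ∑ i, ∑ j, A i j * (u i * u i - u i * u j)
        + ∑ i, ∑ j, A i j * (u j * u j - u i * u j) = ∑ i, ∑ j, A i j * (u i - u j) ^ 2 := by
      simp only [← Finset.sum_add_distrib]
      exact Finset.sum_congr rfl fun i _ => Finset.sum_congr rfl fun j _ => by ring
    have nonneg : 0 ≤ ∑ i, ∑ j, A i j * (u i - u j) ^ 2 :=
      Finset.sum_nonneg fun i _ => Finset.sum_nonneg fun j _ =>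
        mul_nonneg (hA0 i j) (sq_nonneg _)
    rw [key]
    linarith

theorem posSemidef_graphLaplacian {N : ℕ} (κ : GraphKind) (d : ℕ) {ε : ℝ} (hε : 0 < ε) {n : ℕ}
    (x : Fin n → EuclideanSpace ℝ (Fin N)) : (graphLaplacian κ d ε x).PosSemidef := by
  refine posSemidef_diagonal_sub ?_ fun i j => kernel_nonneg κ d n hε _
  ext i j
  simp [adjacency, norm_sub_rev]

/-! ### Graph filters in an eigenbasis -/

theorem exp_smul_eq_conj {n : ℕ} {S : Matrix (Fin n) (Fin n) ℝ} (hS : S.IsHermitian) (c : ℝ) :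
    NormedSpace.exp (c • S) = (hS.eigenvectorUnitary : Matrix (Fin n) (Fin n) ℝ) *
      Matrix.diagonal (fun i => Real.exp (c * hS.eigenvalues i)) *
        star (hS.eigenvectorUnitary : Matrix (Fin n) (Fin n) ℝ) := by
  have hU : star (hS.eigenvectorUnitary : Matrix (Fin n) (Fin n) ℝ)
      = (hS.eigenvectorUnitary : Matrix (Fin n) (Fin n) ℝ)⁻¹ :=
    (Matrix.inv_eq_left_inv (Unitary.coe_star_mul_self _)).symm
  have hunit : IsUnit (hS.eigenvectorUnitary : Matrix (Fin n) (Fin n) ℝ) :=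
    IsUnit.of_mul_eq_one _ (Unitary.coe_mul_star_self hS.eigenvectorUnitary)
  have h : c • S = (hS.eigenvectorUnitary : Matrix (Fin n) (Fin n) ℝ) *
      Matrix.diagonal (fun i => c * hS.eigenvalues i) *
        (hS.eigenvectorUnitary : Matrix (Fin n) (Fin n) ℝ)⁻¹ := by
    conv_lhs => rw [hS.spectral_theorem, Unitary.conjStarAlgAut_apply]
    rw [← hU, ← smul_mul_assoc, ← mul_smul_comm, ← Matrix.diagonal_smul]
    rfl
  rw [h, Matrix.exp_conj _ _ hunit, Matrix.exp_diagonal, hU]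
  congr 3
  ext i
  rw [Pi.coe_exp, Real.exp_eq_exp_ℝ]

theorem integrableOn_mul_exp {h : ℝ → ℝ} (hh : IntegrableOn h (Set.Ioi 0)) {lam : ℝ}
    (hlam : 0 ≤ lam) : IntegrableOn (fun t => h t * Real.exp (-(t * lam))) (Set.Ioi 0) := by
  refine Integrable.mul_bdd (c := 1) hh (by fun_prop) ?_
  filter_upwards [ae_restrict_mem measurableSet_Ioi] with t ht
  rw [Real.norm_eq_abs, Real.abs_exp, Real.exp_le_one_iff, neg_nonpos]
  exact mul_nonneg (le_of_lt ht) hlam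

/-- In an orthonormal eigenbasis of the Laplacian a graph filter multiplies the coordinates by the
frequency response at the eigenvalues. -/
theorem graphFilter_eq_conj {n : ℕ} {S : Matrix (Fin n) (Fin n) ℝ} (hS : S.PosSemidef)
    {h : ℝ → ℝ} (hh : IntegrableOn h (Set.Ioi 0)) (u : Fin n → ℝ) :
    graphFilter h S u = (hS.1.eigenvectorUnitary : Matrix (Fin n) (Fin n) ℝ) *ᵥ
      (Matrix.diagonal (fun i => frequencyResponse h (hS.1.eigenvalues i)) *ᵥ
        (star (hS.1.eigenvectorUnitary : Matrix (Fin n) (Fin n) ℝ) *ᵥ u)) := by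
  set U := (hS.1.eigenvectorUnitary : Matrix (Fin n) (Fin n) ℝ)
  set v := star U *ᵥ u
  have hint : ∀ i, IntegrableOn
      (fun t => h t * Real.exp (-(t * hS.1.eigenvalues i)) * v i) (Set.Ioi 0) := fun i =>
    (integrableOn_mul_exp hh (hS.eigenvalues_nonneg i)).mul_const _
  have hfun : ∀ t, h t • (NormedSpace.exp (-t • S) *ᵥ u)
      = (Matrix.mulVecLin U).toContinuousLinearMap
        (fun i => h t * Real.exp (-(t * hS.1.eigenvalues i)) * v i) := fun t => by
    rw [exp_smul_eq_conj hS.1, ← Matrix.mulVec_mulVec, ← Matrix.mulVec_mulVec,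
      ← Matrix.mulVec_smul]
    change _ = U *ᵥ _
    congr 1
    ext i
    simp only [Pi.smul_apply, Matrix.mulVec_diagonal, smul_eq_mul, neg_mul, mul_assoc]
    rfl
  unfold graphFilter
  simp_rw [hfun]
  rw [ContinuousLinearMap.integral_comp_comm _ (Integrable.of_eval hint)]
  change U *ᵥ _ = U *ᵥ _
  congr 1
  ext i
  rw [eval_integral hint, integral_mul_const, Matrix.mulVec_diagonal]
  rfl

theorem graphNorm_mulVec_of_star_mul_self {n : ℕ} {U : Matrix (Fin n) (Fin n) ℝ}
    (hU : star U * U = 1) (u : Fin n → ℝ) : graphNorm (U *ᵥ u) = graphNorm u := by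
  rw [graphNorm_eq_dotProduct, graphNorm_eq_dotProduct, Matrix.dotProduct_mulVec,
    ← Matrix.mulVec_transpose, Matrix.mulVec_mulVec,
    ← Matrix.conjTranspose_eq_transpose_of_trivial, ← Matrix.star_eq_conjTranspose, hU,
    Matrix.one_mulVec]

/-- A non-amplifying graph filter is linear and a contraction, hence non-expansive. -/
theorem graphNorm_graphFilter_sub_le {n : ℕ} {S : Matrix (Fin n) (Fin n) ℝ} (hS : S.PosSemidef)
    {h : ℝ → ℝ} (hh : IntegrableOn h (Set.Ioi 0)) (hamp : NonAmplifying h) (u v : Fin n → ℝ) :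
    graphNorm (graphFilter h S u - graphFilter h S v) ≤ graphNorm (u - v) := by
  rw [graphFilter_eq_conj hS hh, graphFilter_eq_conj hS hh, ← Matrix.mulVec_sub,
    ← Matrix.mulVec_sub, ← Matrix.mulVec_sub,
    graphNorm_mulVec_of_star_mul_self (Unitary.coe_star_mul_self _)]
  refine le_trans (graphNorm_mono fun i => ?_) (graphNorm_mulVec_of_star_mul_self
    (by rw [star_star]; exact Unitary.coe_mul_star_self hS.1.eigenvectorUnitary) (u - v)).le
  rw [Matrix.mulVec_diagonal, abs_mul]
  exact mul_le_of_le_one_left (abs_nonneg _) (hamp _ (hS.eigenvalues_nonneg i))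

/-! ### Sampling at random points -/

theorem ae_forall_sample {N d n : ℕ} {M : Set (EuclideanSpace ℝ (Fin N))} {Ω : Type*}
    [MeasurableSpace Ω] {P : Measure Ω} {X : Fin n → Ω → EuclideanSpace ℝ (Fin N)}
    (hXm : ∀ i, Measurable (X i)) (hXlaw : ∀ i, P.map (X i) = uniform d M)
    {p : EuclideanSpace ℝ (Fin N) → Prop} (hp : ∀ᵐ y ∂vol d M, p y) :
    ∀ᵐ s ∂P, ∀ i, p (X i s) := by
  refine ae_all_iff.2 fun i => ae_of_ae_map (hXm i).aemeasurable ?_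
  rw [hXlaw i]
  exact Measure.smul_absolutelyContinuous.ae_le hp

theorem coeFn_finset_sum {α ι : Type*} [MeasurableSpace α] {μ : Measure α} (s : Finset ι)
    (g : ι → Lp ℝ 2 μ) : ∀ᵐ y ∂μ, (∑ i ∈ s, g i : Lp ℝ 2 μ) y = ∑ i ∈ s, g i y := by
  classical
  induction s using Finset.induction_on with
  | empty =>
    filter_upwards [Lp.coeFn_zero ℝ 2 μ] with y hy
    simpa using hy
  | insert a s ha ih =>
    rw [Finset.sum_insert ha]
    filter_upwards [Lp.coeFn_add (g a) (∑ i ∈ s, g i), ih] with y hy hys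
    rw [Finset.sum_insert ha, hy, Pi.add_apply, hys]

/-- Almost surely the layer equation of the manifold network holds pointwise at the sample points,
with the representatives chosen by `sample`. -/
theorem ae_sample_mnnFeature_succ {N d n : ℕ} {M : Set (EuclideanSpace ℝ (Fin N))} {Ω : Type*}
    [MeasurableSpace Ω] {P : Measure Ω} {X : Fin n → Ω → EuclideanSpace ℝ (Fin N)}
    (hXm : ∀ i, Measurable (X i)) (hXlaw : ∀ i, P.map (X i) = uniform d M)
    {L F : ℕ} {σ : ℝ → ℝ} (hσ : NormalizedLipschitz σ) (H : Architecture L F) (f : Signal d M) :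
    ∀ᵐ s ∂P, ∀ l p i, sample (fun i => X i s) (mnnFeature hσ H f (l + 1) p) i =
      σ ((∑ q, sample (fun i => X i s)
        (manifoldFilter d M (H l p q) (mnnFeature hσ H f l q))) i) := by
  refine ae_all_iff.2 fun l => ae_all_iff.2 fun p => ?_
  refine (ae_forall_sample hXm hXlaw (p := fun y => mnnFeature hσ H f (l + 1) p y =
    σ (∑ q, manifoldFilter d M (H l p q) (mnnFeature hσ H f l q) y)) ?_).mono fun s hs i => ?_
  · filter_upwards [hσ.lipschitzWith.coeFn_compLp hσ.map_zero
      (∑ q, manifoldFilter d M (H l p q) (mnnFeature hσ H f l q)),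
      coeFn_finset_sum Finset.univ
        fun q => manifoldFilter d M (H l p q) (mnnFeature hσ H f l q)] with y hy hsum
    rw [← hsum]
    exact hy
  · rw [Finset.sum_apply]
    exact hs i

/-! ### Propagation of the error through the layers -/

theorem width_eq_of_pos {L F l : ℕ} (hl : 0 < l) (hlL : l < L) : width L F l = F := by
  simp [width, hl.ne', hlL.ne]

/-- Induction over the layers: `hx` is the layer equation of the manifold network at the sample
points, so both networks apply the same recursion, up to the filter errors. -/
theorem graphNorm_feature_sub_le {N d n : ℕ} {M : Set (EuclideanSpace ℝ (Fin N))}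
    {κ : GraphKind} {ε : ℝ} (hε : 0 < ε) {L F : ℕ} {H : Architecture L F}
    (hHint : ∀ l < L, ∀ p q, IntegrableOn (H l p q) (Set.Ioi 0))
    (hHamp : ∀ l < L, ∀ p q, NonAmplifying (H l p q))
    {σ : ℝ → ℝ} (hσ : NormalizedLipschitz σ) {f : Signal d M} {Δ : ℝ}
    {x : Fin n → EuclideanSpace ℝ (Fin N)}
    (hx : ∀ l p i, sample x (mnnFeature hσ H f (l + 1) p) i =
      σ ((∑ q, sample x (manifoldFilter d M (H l p q) (mnnFeature hσ H f l q))) i))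
    (hclose : FiltersClose hσ H κ ε x f Δ) {l : ℕ} (hl : l ≤ L) (p : Fin (width L F l)) :
    graphNorm (gnnFeature σ H (graphLaplacian κ d ε x) (sample x f) l p -
      sample x (mnnFeature hσ H f l p)) ≤ (l : ℝ) * (F : ℝ) ^ (l - 1) * Δ := by
  induction l with
  | zero => simp [gnnFeature, mnnFeature, graphNorm_zero]
  | succ l ih =>
    have hlL : l < L := hl
    set S := graphLaplacian κ d ε x
    have hS : S.PosSemidef := posSemidef_graphLaplacian κ d hε x
    have hfilter : ∀ q, graphNorm (graphFilter (H l p q) S (gnnFeature σ H S (sample x f) l q) -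
        sample x (manifoldFilter d M (H l p q) (mnnFeature hσ H f l q))) ≤
          (l : ℝ) * (F : ℝ) ^ (l - 1) * Δ + Δ := fun q => by
      rw [← sub_add_sub_cancel _ (graphFilter (H l p q) S (sample x (mnnFeature hσ H f l q)))]
      refine (graphNorm_add_le _ _).trans (add_le_add ?_ (hclose l hlL p q))
      exact (graphNorm_graphFilter_sub_le hS (hHint l hlL p q) (hHamp l hlL p q) _ _).trans
        (ih hlL.le q)
    have hlayer : graphNorm (gnnFeature σ H S (sample x f) (l + 1) p -
        sample x (mnnFeature hσ H f (l + 1) p)) ≤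
          (width L F l : ℝ) * ((l : ℝ) * (F : ℝ) ^ (l - 1) * Δ + Δ) := by
      calc _ ≤ graphNorm (∑ q, (graphFilter (H l p q) S (gnnFeature σ H S (sample x f) l q) -
            sample x (manifoldFilter d M (H l p q) (mnnFeature hσ H f l q)))) := by
            refine graphNorm_mono fun i => ?_
            rw [Finset.sum_sub_distrib, Pi.sub_apply, Pi.sub_apply, hx]
            exact hσ.abs_sub_le _ _
        _ ≤ ∑ q : Fin (width L F l), ((l : ℝ) * (F : ℝ) ^ (l - 1) * Δ + Δ) :=
            (graphNorm_sum_le _ _).trans (Finset.sum_le_sum fun q _ => hfilter q)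
        _ = _ := by rw [Finset.sum_const, Finset.card_univ, Fintype.card_fin, nsmul_eq_mul]
    refine hlayer.trans ?_
    rcases Nat.eq_zero_or_pos l with rfl | hl0
    · simp [width_zero]
    rw [width_eq_of_pos hl0 hlL]
    rcases Nat.eq_zero_or_pos F with rfl | hF
    -- without hidden features the last layers of both networks vanish
    · simp [hl0.ne']
    -- a hidden filter exists, and its error is nonnegative
    have hΔ : 0 ≤ Δ := (graphNorm_nonneg _).trans
      (hclose l hlL p ⟨0, by rwa [width_eq_of_pos hl0 hlL]⟩)
    have hF1 : (F : ℝ) ≤ (F : ℝ) ^ l := le_self_pow₀ (by exact_mod_cast hF) hl0.ne'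
    have hpow : (F : ℝ) * (F : ℝ) ^ (l - 1) = (F : ℝ) ^ l := mul_pow_sub_one hl0.ne' _
    calc (F : ℝ) * ((l : ℝ) * (F : ℝ) ^ (l - 1) * Δ + Δ)
        = (l : ℝ) * (F : ℝ) ^ l * Δ + F * Δ := by rw [← hpow]; ring
      _ ≤ (l : ℝ) * (F : ℝ) ^ l * Δ + (F : ℝ) ^ l * Δ := by gcongr
      _ = ((l + 1 : ℕ) : ℝ) * (F : ℝ) ^ (l + 1 - 1) * Δ := by
          rw [Nat.add_sub_cancel]; push_cast; ring

/-- The union bound over all filters of the architecture. -/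
theorem measure_not_filtersClose_le {N d n : ℕ} {M : Set (EuclideanSpace ℝ (Fin N))} {Ω : Type*}
    [MeasurableSpace Ω] {P : Measure Ω} (X : Fin n → Ω → EuclideanSpace ℝ (Fin N))
    {κ : GraphKind} {ε : ℝ} {L F : ℕ} {H : Architecture L F}
    {σ : ℝ → ℝ} (hσ : NormalizedLipschitz σ) {f : Signal d M} {Δ : ℝ} {δ : ℝ≥0∞}
    (h : ∀ l < L, ∀ p q, P {s | ¬ filterError κ ε (fun i => X i s) (H l p q)
      (mnnFeature hσ H f l q) ≤ Δ} ≤ δ) :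
    P {s | ¬ FiltersClose hσ H κ ε (fun i => X i s) f Δ} ≤
      ((∑ l ∈ Finset.range L, width L F (l + 1) * width L F l : ℕ) : ℝ≥0∞) * δ := by
  have hset : {s | ¬ FiltersClose hσ H κ ε (fun i => X i s) f Δ} ⊆
      ⋃ l ∈ Finset.range L, ⋃ p, ⋃ q, {s | ¬ filterError κ ε (fun i => X i s) (H l p q)
        (mnnFeature hσ H f l q) ≤ Δ} := by
    intro s hs
    simp only [FiltersClose, Set.mem_ofPred_eq, not_forall] at hs
    obtain ⟨l, hl, p, q, hpq⟩ := hs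
    simp only [Set.mem_iUnion]
    exact ⟨l, Finset.mem_range.2 hl, p, q, hpq⟩
  refine (measure_mono hset).trans ((measure_biUnion_finset_le _ _).trans ?_)
  rw [Nat.cast_sum, Finset.sum_mul]
  refine Finset.sum_le_sum fun l hl => ?_
  refine (measure_iUnion_fintype_le _ _).trans ((Finset.sum_le_sum fun p _ =>
    (measure_iUnion_fintype_le _ _).trans (Finset.sum_le_sum fun q _ =>
      h l (Finset.mem_range.1 hl) p q)).trans_eq ?_)
  simp [mul_assoc]

end MNN

theorem mainTheorem3
    {N d : ℕ} (M : Set (EuclideanSpace ℝ (Fin N)))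
    (hM : MNN.IsSmoothSubmanifold d M) (hMc : IsCompact M) (hMne : M.Nonempty)
    {Ω : Type*} [MeasurableSpace Ω] (P : Measure Ω) [IsProbabilityMeasure P]
    (n : ℕ) (hn : 1 ≤ n) (X : Fin n → Ω → EuclideanSpace ℝ (Fin N))
    (hXm : ∀ i, Measurable (X i)) (hXind : iIndepFun X P)
    (hXlaw : ∀ i, P.map (X i) = MNN.uniform d M)
    (κ : MNN.GraphKind) (ε : ℝ) (hε : 0 < ε)
    (L F : ℕ) (hL : 1 ≤ L) (H : MNN.Architecture L F)
    (hHint : ∀ l < L, ∀ p q, IntegrableOn (H l p q) (Set.Ioi 0))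
    (hHamp : ∀ l < L, ∀ p q, MNN.NonAmplifying (H l p q))
    (σ : ℝ → ℝ) (hσ : MNN.NormalizedLipschitz σ)
    (f : MNN.Signal d M) (Δ : ℝ) :
    -- almost surely, the filter bounds imply the network bound
    (∀ᵐ s ∂P, MNN.FiltersClose hσ H κ ε (fun i => X i s) f Δ →
      MNN.networkError hσ H κ ε (fun i => X i s) f ≤ (L : ℝ) * (F : ℝ) ^ (L - 1) * Δ) ∧
    -- the network bound fails with probability at most `δ` if the filter bounds hold together
    -- outside an event of probability at most `δ`
    (∀ δ : ℝ≥0∞, P {s | ¬ MNN.FiltersClose hσ H κ ε (fun i => X i s) f Δ} ≤ δ →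
      P {s | ¬ MNN.networkError hσ H κ ε (fun i => X i s) f ≤ (L : ℝ) * (F : ℝ) ^ (L - 1) * Δ}
        ≤ δ) ∧
    -- if each single filter bound fails with probability at most `δ`, then the network bound fails
    -- with probability at most `δ` times the number of filters
    (∀ δ : ℝ≥0∞, (∀ l < L, ∀ p q, P {s | ¬ MNN.filterError κ ε (fun i => X i s) (H l p q)
          (MNN.mnnFeature hσ H f l q) ≤ Δ} ≤ δ) →
      P {s | ¬ MNN.networkError hσ H κ ε (fun i => X i s) f ≤ (L : ℝ) * (F : ℝ) ^ (L - 1) * Δ}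
        ≤ ((∑ l ∈ Finset.range L, MNN.width L F (l + 1) * MNN.width L F l : ℕ) : ℝ≥0∞) * δ) := by
  have hae : ∀ᵐ s ∂P, MNN.FiltersClose hσ H κ ε (fun i => X i s) f Δ →
      MNN.networkError hσ H κ ε (fun i => X i s) f ≤ (L : ℝ) * (F : ℝ) ^ (L - 1) * Δ :=
    (MNN.ae_sample_mnnFeature_succ hXm hXlaw hσ H f).mono fun s hs hclose =>
      MNN.graphNorm_feature_sub_le hε hHint hHamp hσ hs hclose le_rfl _
  have hle : P {s | ¬ MNN.networkError hσ H κ ε (fun i => X i s) f ≤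
      (L : ℝ) * (F : ℝ) ^ (L - 1) * Δ} ≤
        P {s | ¬ MNN.FiltersClose hσ H κ ε (fun i => X i s) f Δ} :=
    measure_mono_ae (hae.mono fun s hs => mt hs)
  exact ⟨hae, fun δ hδ => hle.trans hδ,
    fun δ hδ => hle.trans (MNN.measure_not_filtersClose_le X hσ hδ)⟩
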